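/- Let $T\subseteq\mathbb R$ be an interval of positive length, let $A\in\mathbb R^{n\times n}$ and $B\in\mathbb R^{n\times m}$ be constant matrices, let $u:T\to\mathbb R^m$, and for each $t\in T$ let $D=D(t)\in\mathbb R^{n\times n}$ be a diagonal matrix with $D_{ii}>0$ for all $i$. Consider the linear Langevin system $\dot x=f(x;t)+\xi(t)$ with drift $f(x;t)=Ax+Bu(t)$ and noise $\langle\xi_i(t)\rangle=0$, $\langle\xi_i(t)\xi_j(t')\rangle=2D_{ij}(t)\delta(t-t')$. Let $\mu:T\to\mathbb R^n$ and $\Sigma:T\to\mathbb R^{n\times n}$ be differentiable (one-sidedly at end points belonging to $T$), with $\Sigma(t)$ symmetric positive definite, such that on $T$ $$\dot\mu=A\mu+Bu,\qquad \dot\Sigma=A\Sigma+\Sigma A^\top+2D,$$ and let $$p(x;t)=\frac{1}{\sqrt{\det(2\pi\Sigma(t))}}\exp\Big(-\tfrac12(x-\mu(t))^\top\Sigma(t)^{-1}(x-\mu(t))\Big)$$ be the Gaussian density with mean $\mu(t)$ and covariance $\Sigma(t)$. Define the probability current $J_i=f_i\,p-\sum_j D_{ij}\,\partial p/\partial x_j$,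 the entropy production, the entropy flux and the entropy $$\Pi=\int_{\mathbb R^n}\sum_i\frac{J_i^2}{D_{ii}\,p}\,dx,\qquad \Phi=\int_{\mathbb R^n}\sum_i\frac{J_i f_i}{D_{ii}}\,dx,\qquad S=-\int_{\mathbb R^n}p\ln p\,dx .$$ Then at every $t\in T$ these integrals converge absolutely, and $$\Pi=\dot\mu^\top D^{-1}\dot\mu+\mathrm{Tr}(A^\top D^{-1}A\Sigma)+\mathrm{Tr}(\Sigma^{-1}D)+2\,\mathrm{Tr}(A),$$ $$\Phi=\dot\mu^\top D^{-1}\dot\mu+\mathrm{Tr}(A^\top D^{-1}A\Sigma)+\mathrm{Tr}(A).$$ Moreover $S$ and $p(x;\cdot)$ are differentiable on $T$, the integral below converges absolutely, and $$\dot S=-\int_{\mathbb R^n}\dot p\,\ln p\,dx=\Pi-\Phi=\mathrm{Tr}(\Sigma^{-1}D)+\mathrm{Tr}(A)=\tfrac12\mathrm{Tr}(\Sigma^{-1}\dot\Sigma)=\tfrac12\frac{d}{dt}\ln\det\Sigma .$$ -/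

import Mathlib

open MeasureTheory Matrix

noncomputable section

/-- The drift `f(x; t) = A x + B u(t)` of the linear Langevin system `dx/dt = f(x; t) + ξ(t)`,
at a time at which the input takes the value `u`. -/
def linearDrift {n m : ℕ} (A : Matrix (Fin n) (Fin n) ℝ) (B : Matrix (Fin n) (Fin m) ℝ)
    (u : Fin m → ℝ) (x : Fin n → ℝ) : Fin n → ℝ :=
  A *ᵥ x + B *ᵥ u

/-- The Gaussian probability density on `ℝⁿ` with mean `μ` and covariance matrix `S`,
`(det (2πS))^(-1/2) exp (-½ (x - μ)ᵀ S⁻¹ (x - μ))`. -/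
def gaussianDensity {n : ℕ} (μ : Fin n → ℝ) (S : Matrix (Fin n) (Fin n) ℝ)
    (x : Fin n → ℝ) : ℝ :=
  1 / Real.sqrt (((2 * Real.pi) • S).det) *
    Real.exp (-(1 / 2) * ((x - μ) ⬝ᵥ (S⁻¹ *ᵥ (x - μ))))

/-- The partial derivative `∂p/∂x_j` at `x`. -/
def partialDeriv {n : ℕ} (p : (Fin n → ℝ) → ℝ) (j : Fin n) (x : Fin n → ℝ) : ℝ :=
  lineDeriv ℝ p x (Pi.single j 1)

/-- The `i`-th component `J_i = f_i p - ∑ j, D_ij ∂p/∂x_j` of the probability current of the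
Fokker-Planck equation with drift `f` and noise matrix `D`, for a density `p`. -/
def probabilityCurrent {n : ℕ} (D : Matrix (Fin n) (Fin n) ℝ) (f : (Fin n → ℝ) → Fin n → ℝ)
    (p : (Fin n → ℝ) → ℝ) (i : Fin n) (x : Fin n → ℝ) : ℝ :=
  f x i * p x - ∑ j, D i j * partialDeriv p j x

/-- The integrand `∑ i, J_i² / (D_ii p)` of the entropy production. -/
def entropyProductionIntegrand {n : ℕ} (D : Matrix (Fin n) (Fin n) ℝ)
    (f : (Fin n → ℝ) → Fin n → ℝ) (p : (Fin n → ℝ) → ℝ) (x : Fin n → ℝ) : ℝ :=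
  ∑ i, probabilityCurrent D f p i x ^ 2 / (D i i * p x)

/-- The entropy production `Π = ∫ ∑ i, J_i² / (D_ii p) dx`. -/
def entropyProduction {n : ℕ} (D : Matrix (Fin n) (Fin n) ℝ)
    (f : (Fin n → ℝ) → Fin n → ℝ) (p : (Fin n → ℝ) → ℝ) : ℝ :=
  ∫ x, entropyProductionIntegrand D f p x

/-- The integrand `∑ i, J_i f_i / D_ii` of the entropy flux (for a diagonal noise matrix). -/
def entropyFluxIntegrand {n : ℕ} (D : Matrix (Fin n) (Fin n) ℝ)
    (f : (Fin n → ℝ) → Fin n → ℝ) (p : (Fin n → ℝ) → ℝ) (x : Fin n → ℝ) : ℝ :=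
  ∑ i, probabilityCurrent D f p i x * f x i / D i i

/-- The entropy flux `Φ = ∫ ∑ i, J_i f_i / D_ii dx` (for a diagonal noise matrix). -/
def entropyFlux {n : ℕ} (D : Matrix (Fin n) (Fin n) ℝ)
    (f : (Fin n → ℝ) → Fin n → ℝ) (p : (Fin n → ℝ) → ℝ) : ℝ :=
  ∫ x, entropyFluxIntegrand D f p x

/-- The entropy `S = -∫ p ln p dx` of a probability density. -/
def densityEntropy {n : ℕ} (p : (Fin n → ℝ) → ℝ) : ℝ :=
  -∫ x, p x * Real.log (p x)

end

/-! Everything reduces to Gaussian moments. Put `y = x - μ`. The mean equation turns the drift into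
`μ' + A y`, and since `∇p = -Σ⁻¹ y p`, the current is `(μ' + (A + D Σ⁻¹) y) p`. Both integrands are
therefore `p` times a `D⁻¹`-pairing of two affine functions of `y`. Linear terms average to zero and
the quadratic term averages to a trace (`hasWeightedIntegral_gaussian_affine`). Expanding that
trace, `D⁻¹` cancels `D`: each cross term yields `Tr A`, and the square of `D Σ⁻¹` yields `Tr (Σ⁻¹
D)`.

The entropy is `½ ln det Σ` plus a constant, so its rate follows from Jacobi's formula and the
covariance equation, with no differentiation under the integral sign. The integral of `ṗ ln p` is
computed separately and found to match: `ṗ / p` and `ln p` are both quadratic in `y`, so fourth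
moments enter, but one factor is always the form `Σ⁻¹`.

The moments come from writing `Σ = R Rᵀ` and `x = μ + R z`, which makes the coordinates of `z`
independent standard normals and turns the form `Σ⁻¹` into `|z|²`. -/

noncomputable section

variable {n : ℕ}

/-! ### Integrals against a weight -/

/-- `g` is integrable against the weight `w`, with integral `v`. -/
def HasWeightedIntegral (w g : (Fin n → ℝ) → ℝ) (v : ℝ) : Prop :=
  Integrable (fun x => g x * w x) ∧ ∫ x, g x * w x = v

namespace HasWeightedIntegral

variable {w g h : (Fin n → ℝ) → ℝ} {a b : ℝ}

theorem add (hg : HasWeightedIntegral w g a) (hh : HasWeightedIntegral w h b) :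
    HasWeightedIntegral w (fun x => g x + h x) (a + b) := by
  refine ⟨?_, ?_⟩
  · simpa only [add_mul] using hg.1.fun_add hh.1
  · simp only [add_mul]
    rw [integral_add hg.1 hh.1, hg.2, hh.2]

theorem const_mul (c : ℝ) (hg : HasWeightedIntegral w g a) :
    HasWeightedIntegral w (fun x => c * g x) (c * a) := by
  refine ⟨?_, ?_⟩
  · simpa only [mul_assoc] using hg.1.const_mul c
  · simp only [mul_assoc]
    rw [integral_const_mul, hg.2]

theorem sum {ι : Type*} (s : Finset ι) {G : ι → (Fin n → ℝ) → ℝ} {v : ι → ℝ}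
    (hG : ∀ i ∈ s, HasWeightedIntegral w (G i) (v i)) :
    HasWeightedIntegral w (fun x => ∑ i ∈ s, G i x) (∑ i ∈ s, v i) := by
  refine ⟨?_, ?_⟩
  · simpa only [Finset.sum_mul] using integrable_finsetSum s fun i hi => (hG i hi).1
  · simp only [Finset.sum_mul]
    rw [integral_finsetSum s fun i hi => (hG i hi).1]
    exact Finset.sum_congr rfl fun i hi => (hG i hi).2

theorem congr (hg : HasWeightedIntegral w g a) (hgh : ∀ x, h x = g x) (hab : b = a) :
    HasWeightedIntegral w h b := by
  obtain rfl : h = g := funext hgh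
  rwa [hab]

end HasWeightedIntegral

/-! ### Moments of the standard normal on the line -/

/-- The standard normal weight on the real line. -/
def stdNormalWeight (x : ℝ) : ℝ :=
  1 / Real.sqrt (2 * Real.pi) * Real.exp (-(1 / 2) * x ^ 2)

theorem integrable_pow_mul_stdNormalWeight (k : ℕ) :
    Integrable (fun x : ℝ => x ^ k * stdNormalWeight x) := by
  have h := (integrable_rpow_mul_exp_neg_mul_sq (b := 1 / 2) (by norm_num) (s := k)
    (by have : (0 : ℝ) ≤ k := k.cast_nonneg
        linarith)).const_mul (1 / Real.sqrt (2 * Real.pi))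
  refine h.congr (Filter.Eventually.of_forall fun x => ?_)
  simp only [Real.rpow_natCast, stdNormalWeight]
  ring

theorem hasDerivAt_stdNormalWeight (x : ℝ) :
    HasDerivAt stdNormalWeight (-x * stdNormalWeight x) x := by
  have h := ((((hasDerivAt_id x).pow 2).const_mul (-(1 / 2 : ℝ))).exp).const_mul
    (1 / Real.sqrt (2 * Real.pi))
  refine h.congr_deriv ?_
  simp [stdNormalWeight]
  ring

/-- The moments of the standard normal distribution. -/
def stdNormalMoment (k : ℕ) : ℝ := ∫ x : ℝ, x ^ k * stdNormalWeight x

theorem stdNormalMoment_zero : stdNormalMoment 0 = 1 := by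
  simp only [stdNormalMoment, stdNormalWeight, pow_zero, one_mul, integral_const_mul,
    integral_gaussian]
  rw [show Real.pi / (1 / 2) = 2 * Real.pi by ring]
  have : Real.sqrt (2 * Real.pi) ≠ 0 := by positivity
  field_simp

theorem stdNormalMoment_one : stdNormalMoment 1 = 0 := by
  have h := integral_eq_zero_of_hasDerivAt_of_integrable hasDerivAt_stdNormalWeight
    ((integrable_pow_mul_stdNormalWeight 1).neg.congr
      (Filter.Eventually.of_forall fun x => by simp))
    (by simpa using integrable_pow_mul_stdNormalWeight 0)
  simpa [stdNormalMoment, integral_neg] using h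

/-- Integration by parts: the derivative of `x ^ (k + 1)` times the weight has integral zero. -/
theorem stdNormalMoment_add_two (k : ℕ) :
    stdNormalMoment (k + 2) = (k + 1) * stdNormalMoment k := by
  have hd : ∀ x : ℝ, HasDerivAt (fun x => x ^ (k + 1) * stdNormalWeight x)
      ((k + 1) * (x ^ k * stdNormalWeight x) - x ^ (k + 2) * stdNormalWeight x) x := fun x => by
    refine ((hasDerivAt_pow (k + 1) x).mul (hasDerivAt_stdNormalWeight x)).congr_deriv ?_
    simp only [Nat.cast_add, Nat.cast_one, Nat.add_sub_cancel]
    ring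
  have h₁ := (integrable_pow_mul_stdNormalWeight k).const_mul ((k : ℝ) + 1)
  have h₂ := integrable_pow_mul_stdNormalWeight (k + 2)
  have h := integral_eq_zero_of_hasDerivAt_of_integrable hd (h₁.sub h₂)
    (integrable_pow_mul_stdNormalWeight (k + 1))
  rw [integral_sub h₁ h₂, integral_const_mul] at h
  exact (sub_eq_zero.mp h).symm

theorem stdNormalMoment_two : stdNormalMoment 2 = 1 := by
  rw [stdNormalMoment_add_two 0, stdNormalMoment_zero]; norm_num

theorem stdNormalMoment_three : stdNormalMoment 3 = 0 := by
  rw [stdNormalMoment_add_two 1, stdNormalMoment_one, mul_zero]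

theorem stdNormalMoment_four : stdNormalMoment 4 = 3 := by
  rw [stdNormalMoment_add_two 2, stdNormalMoment_two]; norm_num

/-! ### Moments of the standard normal on `ℝⁿ`, up to order four -/

/-- The standard normal weight on `ℝⁿ`. -/
def stdNormalProd (z : Fin n → ℝ) : ℝ := ∏ i, stdNormalWeight (z i)

theorem hasWeightedIntegral_monomial (a : Fin n → ℕ) :
    HasWeightedIntegral stdNormalProd (fun z => ∏ i, z i ^ a i) (∏ i, stdNormalMoment (a i)) := by
  have h : (fun z : Fin n → ℝ => (∏ i, z i ^ a i) * stdNormalProd z) =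
      fun z => ∏ i, (fun i x => x ^ a i * stdNormalWeight x) i (z i) := by
    funext z
    simp [stdNormalProd, Finset.prod_mul_distrib]
  refine ⟨?_, ?_⟩
  · rw [h]
    exact Integrable.fintype_prod fun i => integrable_pow_mul_stdNormalWeight (a i)
  · rw [h]
    exact integral_fintype_prod_volume_eq_prod fun i x => x ^ a i * stdNormalWeight x

theorem hasWeightedIntegral_std_one :
    HasWeightedIntegral (stdNormalProd (n := n)) (fun _ => 1) 1 :=
  (hasWeightedIntegral_monomial 0).congr (by simp) (by simp [stdNormalMoment_zero])

theorem prod_pow_single (z : Fin n → ℝ) (i : Fin n) (k : ℕ) :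
    ∏ l, z l ^ (Pi.single i k : Fin n → ℕ) l = z i ^ k := by
  rw [Finset.prod_eq_single i]
  · simp
  · intro l _ hl
    simp [hl]
  · simp

theorem hasWeightedIntegral_std_coord (i : Fin n) :
    HasWeightedIntegral stdNormalProd (fun z => z i) 0 :=
  (hasWeightedIntegral_monomial (Pi.single i 1)).congr
    (fun z => by rw [prod_pow_single, pow_one])
    (Finset.prod_eq_zero (Finset.mem_univ i) (by simp [stdNormalMoment_one])).symm

theorem hasWeightedIntegral_std_coord_mul_sq (i k : Fin n) :
    HasWeightedIntegral stdNormalProd (fun z => z i * z k ^ 2) 0 := by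
  refine (hasWeightedIntegral_monomial (Pi.single i 1 + Pi.single k 2)).congr
    (fun z => by simp only [Pi.add_apply, pow_add, Finset.prod_mul_distrib, prod_pow_single, pow_one])
    (Finset.prod_eq_zero (Finset.mem_univ i) ?_).symm
  by_cases h : i = k
  · subst h; simp [stdNormalMoment_three]
  · simp [h, stdNormalMoment_one]

theorem hasWeightedIntegral_std_coord_mul_coord (i j : Fin n) :
    HasWeightedIntegral stdNormalProd (fun z => z i * z j) (if i = j then 1 else 0) := by
  refine (hasWeightedIntegral_monomial (Pi.single i 1 + Pi.single j 1)).congr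
    (fun z => by simp only [Pi.add_apply, pow_add, Finset.prod_mul_distrib, prod_pow_single, pow_one])
    ?_
  split_ifs with h
  · subst h
    refine (Finset.prod_eq_one fun l _ => ?_).symm
    by_cases hl : l = i
    · subst hl; simp [stdNormalMoment_two]
    · simp [hl, stdNormalMoment_zero]
  · exact (Finset.prod_eq_zero (Finset.mem_univ i) (by simp [h, stdNormalMoment_one])).symm

/-- For `i ≠ j` the exponent of `z i` is odd. For `i = j` the value is 3, the fourth moment, when `k
= i`, and otherwise a product of second moments. -/
theorem hasWeightedIntegral_std_coord_mul_coord_mul_sq (i j k : Fin n) :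
    HasWeightedIntegral stdNormalProd (fun z => z i * z j * z k ^ 2)
      (if i = j then 1 + 2 * (if i = k then 1 else 0) else 0) := by
  refine (hasWeightedIntegral_monomial (Pi.single i 1 + Pi.single j 1 + Pi.single k 2)).congr
    (fun z => by simp only [Pi.add_apply, pow_add, Finset.prod_mul_distrib, prod_pow_single, pow_one])
    ?_
  split_ifs with h h'
  · subst h h'
    rw [Finset.prod_eq_single i]
    · simp [stdNormalMoment_four]; norm_num
    · intro l _ hl
      simp [hl, stdNormalMoment_zero]
    · simp
  · subst h
    rw [mul_zero, add_zero]
    refine (Finset.prod_eq_one fun l _ => ?_).symm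
    by_cases hl : l = i
    · subst hl; simp [h', stdNormalMoment_two]
    · by_cases hk : l = k
      · subst hk; simp [hl, stdNormalMoment_two]
      · simp [hl, hk, stdNormalMoment_zero]
  · refine (Finset.prod_eq_zero (Finset.mem_univ i) ?_).symm
    by_cases hk : i = k
    · subst hk; simp [h, stdNormalMoment_three]
    · simp [h, hk, stdNormalMoment_one]

theorem hasWeightedIntegral_std_linear (w : Fin n → ℝ) :
    HasWeightedIntegral stdNormalProd (fun z => w ⬝ᵥ z) 0 :=
  (HasWeightedIntegral.sum Finset.univ fun i _ =>
    (hasWeightedIntegral_std_coord i).const_mul (w i)).congr (fun _ => rfl) (by simp)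

theorem hasWeightedIntegral_std_quadratic (N : Matrix (Fin n) (Fin n) ℝ) :
    HasWeightedIntegral stdNormalProd (fun z => z ⬝ᵥ (N *ᵥ z)) N.trace := by
  refine (HasWeightedIntegral.sum Finset.univ fun i _ => HasWeightedIntegral.sum Finset.univ
    fun j _ => (hasWeightedIntegral_std_coord_mul_coord i j).const_mul (N i j)).congr
    (fun z => ?_) (by simp [trace])
  simp only [dotProduct, mulVec, Finset.mul_sum]
  exact Finset.sum_congr rfl fun i _ => Finset.sum_congr rfl fun j _ => by ring

theorem hasWeightedIntegral_std_linear_mul_sq (w : Fin n → ℝ) :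
    HasWeightedIntegral stdNormalProd (fun z => (w ⬝ᵥ z) * (z ⬝ᵥ z)) 0 := by
  refine (HasWeightedIntegral.sum Finset.univ fun i _ => HasWeightedIntegral.sum Finset.univ
    fun k _ => (hasWeightedIntegral_std_coord_mul_sq i k).const_mul (w i)).congr
    (fun z => ?_) (by simp)
  simp only [dotProduct, Finset.sum_mul_sum]
  exact Finset.sum_congr rfl fun i _ => Finset.sum_congr rfl fun j _ => by ring

/-- Only the diagonal of `N` survives, and each of its entries is weighted by the sum over `k` of `1
+ 2 δ_ik`, which is `n + 2`. -/
theorem hasWeightedIntegral_std_quadratic_mul_sq (N : Matrix (Fin n) (Fin n) ℝ) :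
    HasWeightedIntegral stdNormalProd (fun z => (z ⬝ᵥ (N *ᵥ z)) * (z ⬝ᵥ z))
      ((n + 2) * N.trace) := by
  refine (HasWeightedIntegral.sum Finset.univ fun i _ => HasWeightedIntegral.sum Finset.univ
    fun j _ => HasWeightedIntegral.sum Finset.univ fun k _ =>
    (hasWeightedIntegral_std_coord_mul_coord_mul_sq i j k).const_mul (N i j)).congr
    (fun z => ?_) ?_
  · simp only [dotProduct, mulVec, Finset.mul_sum, Finset.sum_mul]
    rw [Finset.sum_comm]
    refine Finset.sum_congr rfl fun i _ => ?_
    rw [Finset.sum_comm]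
    exact Finset.sum_congr rfl fun i _ => Finset.sum_congr rfl fun j _ => by ring
  · simp only [← Finset.mul_sum]
    simp only [mul_ite, mul_zero, Finset.sum_ite_irrel, Finset.sum_const_zero, Finset.sum_ite_eq,
      Finset.mem_univ, if_true, Finset.sum_add_distrib, mul_one]
    simp [trace, Finset.mul_sum]
    exact Finset.sum_congr rfl fun i _ => by ring

/-! ### Time derivatives of determinants, inverses and products -/

/-- Jacobi's formula. Differentiating the Leibniz expansion replaces one column of `S` at a time by
that of `S'`; by Cramer's rule these determinants are the diagonal entries of `adj(S) S'`. -/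
theorem hasDerivWithinAt_det {S : ℝ → Matrix (Fin n) (Fin n) ℝ} {S' : Matrix (Fin n) (Fin n) ℝ}
    {T : Set ℝ} {t : ℝ} (h : ∀ i j, HasDerivWithinAt (fun s => S s i j) (S' i j) T t) :
    HasDerivWithinAt (fun s => (S s).det) ((S t).adjugate * S').trace T t := by
  simp only [det_apply']
  refine (HasDerivWithinAt.fun_sum fun σ _ => (HasDerivWithinAt.fun_finsetProd
    fun i _ => h (σ i) i).const_mul _).congr_deriv ?_
  have h₁ : ∀ i, ((S t).adjugate * S') i i = ((S t).updateCol i fun k => S' k i).det := fun i => by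
    rw [← cramer_apply, cramer_eq_adjugate_mulVec]
    rfl
  simp only [trace, diag_apply, h₁, det_apply', Finset.mul_sum]
  rw [Finset.sum_comm]
  refine Finset.sum_congr rfl fun i _ => Finset.sum_congr rfl fun σ _ => ?_
  rw [← Finset.prod_erase_mul _ _ (Finset.mem_univ i), updateCol_self, smul_eq_mul]
  congr 2
  exact Finset.prod_congr rfl fun j hj => by rw [updateCol_ne (Finset.ne_of_mem_erase hj)]

theorem differentiableWithinAt_inv_apply {S : ℝ → Matrix (Fin n) (Fin n) ℝ}
    {T : Set ℝ} {t : ℝ} (h : ∀ i j, DifferentiableWithinAt ℝ (fun s => S s i j) T t)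
    (hdet : (S t).det ≠ 0) (i j : Fin n) :
    DifferentiableWithinAt ℝ (fun s => (S s)⁻¹ i j) T t := by
  simp only [inv_def, Matrix.smul_apply, Ring.inverse_eq_inv', smul_eq_mul, adjugate_apply]
  refine DifferentiableWithinAt.mul (DifferentiableWithinAt.inv
    (hasDerivWithinAt_det fun i j => (h i j).hasDerivWithinAt).differentiableWithinAt hdet) ?_
  -- An adjugate entry is the determinant of `S` with one row made constant, so Jacobi's formula
  -- applies again; only differentiability matters here.
  refine (hasDerivWithinAt_det (S' := of fun k l => derivWithin
    (fun s => (S s).updateRow j (Pi.single i 1) k l) T t) fun k l => ?_).differentiableWithinAt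
  refine DifferentiableWithinAt.hasDerivWithinAt (f := fun s =>
    (S s).updateRow j (Pi.single i 1) k l) ?_
  by_cases hk : k = j
  · subst hk; simp [differentiableWithinAt_const]
  · simpa [hk] using h k l

theorem hasDerivWithinAt_mul_apply {P Q : ℝ → Matrix (Fin n) (Fin n) ℝ}
    {P' Q' : Matrix (Fin n) (Fin n) ℝ} {T : Set ℝ} {t : ℝ}
    (hP : ∀ i j, HasDerivWithinAt (fun s => P s i j) (P' i j) T t)
    (hQ : ∀ i j, HasDerivWithinAt (fun s => Q s i j) (Q' i j) T t) (i j : Fin n) :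
    HasDerivWithinAt (fun s => (P s * Q s) i j) ((P' * Q t + P t * Q') i j) T t := by
  simp only [mul_apply, Matrix.add_apply, ← Finset.sum_add_distrib]
  exact HasDerivWithinAt.fun_sum fun k _ => (hP i k).mul (hQ k j)

theorem hasDerivWithinAt_inv_apply {S : ℝ → Matrix (Fin n) (Fin n) ℝ}
    {S' : Matrix (Fin n) (Fin n) ℝ} {T : Set ℝ} {t : ℝ} (ht : t ∈ T)
    (hT : UniqueDiffWithinAt ℝ T t)
    (h : ∀ i j, HasDerivWithinAt (fun s => S s i j) (S' i j) T t)
    (hdet : ∀ s ∈ T, (S s).det ≠ 0) (i j : Fin n) :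
    HasDerivWithinAt (fun s => (S s)⁻¹ i j) ((-((S t)⁻¹ * S' * (S t)⁻¹)) i j) T t := by
  set Q' : Matrix (Fin n) (Fin n) ℝ := of fun k l => derivWithin (fun s => (S s)⁻¹ k l) T t
  have hQ : ∀ k l, HasDerivWithinAt (fun s => (S s)⁻¹ k l) (Q' k l) T t := fun k l =>
    (differentiableWithinAt_inv_apply (fun i j => (h i j).differentiableWithinAt)
      (hdet t ht) k l).hasDerivWithinAt
  have hu : IsUnit (S t).det := (hdet t ht).isUnit
  -- Differentiate `S⁻¹ S = 1` on `T`; uniqueness of the derivative within `T` forces the product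
  -- rule to give zero.
  have key : Q' * S t + (S t)⁻¹ * S' = 0 := by
    ext k l
    refine hT.eq_deriv _ (hasDerivWithinAt_mul_apply hQ h k l) ?_
    refine (hasDerivWithinAt_const t T ((1 : Matrix (Fin n) (Fin n) ℝ) k l)).congr_of_mem
      (fun s hs => ?_) ht
    rw [nonsing_inv_mul _ (hdet s hs).isUnit]
  have : Q' = -((S t)⁻¹ * S' * (S t)⁻¹) := by
    rw [← Matrix.neg_mul, ← eq_neg_of_add_eq_zero_left key, mul_nonsing_inv_cancel_right _ _ hu]
  rw [← this]
  exact hQ i j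

theorem hasDerivWithinAt_log_det {S : ℝ → Matrix (Fin n) (Fin n) ℝ}
    {S' : Matrix (Fin n) (Fin n) ℝ} {T : Set ℝ} {t : ℝ}
    (h : ∀ i j, HasDerivWithinAt (fun s => S s i j) (S' i j) T t) (hdet : (S t).det ≠ 0) :
    HasDerivWithinAt (fun s => Real.log (S s).det) ((S t)⁻¹ * S').trace T t := by
  refine ((hasDerivWithinAt_det h).log hdet).congr_deriv ?_
  rw [inv_def, Ring.inverse_eq_inv', smul_mul_assoc, trace_smul, smul_eq_mul, div_eq_inv_mul]

theorem hasDerivWithinAt_dotProduct {v w : ℝ → Fin n → ℝ} {v' w' : Fin n → ℝ} {T : Set ℝ} {t : ℝ}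
    (hv : ∀ i, HasDerivWithinAt (fun s => v s i) (v' i) T t)
    (hw : ∀ i, HasDerivWithinAt (fun s => w s i) (w' i) T t) :
    HasDerivWithinAt (fun s => v s ⬝ᵥ w s) (v' ⬝ᵥ w t + v t ⬝ᵥ w') T t := by
  simp only [dotProduct, ← Finset.sum_add_distrib]
  exact HasDerivWithinAt.fun_sum fun k _ => (hv k).mul (hw k)

theorem hasDerivWithinAt_mulVec {P : ℝ → Matrix (Fin n) (Fin n) ℝ} {v : ℝ → Fin n → ℝ}
    {P' : Matrix (Fin n) (Fin n) ℝ} {v' : Fin n → ℝ} {T : Set ℝ} {t : ℝ}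
    (hP : ∀ i j, HasDerivWithinAt (fun s => P s i j) (P' i j) T t)
    (hv : ∀ i, HasDerivWithinAt (fun s => v s i) (v' i) T t) (i : Fin n) :
    HasDerivWithinAt (fun s => (P s *ᵥ v s) i) ((P' *ᵥ v t + P t *ᵥ v') i) T t :=
  hasDerivWithinAt_dotProduct (fun j => hP i j) hv

/-! ### Gaussian moments by standardization -/

theorem abs_det_mul_gaussianDensity (μ : Fin n → ℝ) {R : Matrix (Fin n) (Fin n) ℝ}
    (hR : R.det ≠ 0) (z : Fin n → ℝ) :
    |R.det| * gaussianDensity μ (R * Rᵀ) (μ + R *ᵥ z) = stdNormalProd z := by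
  have hu : IsUnit R.det := hR.isUnit
  have hut : IsUnit Rᵀ.det := by rwa [det_transpose]
  have hq : (R *ᵥ z) ⬝ᵥ ((R * Rᵀ)⁻¹ *ᵥ (R *ᵥ z)) = ∑ i, z i ^ 2 := by
    rw [Matrix.mul_inv_rev, mulVec_mulVec, Matrix.mul_assoc, nonsing_inv_mul _ hu, Matrix.mul_one,
      ← vecMul_transpose, ← dotProduct_mulVec, mulVec_mulVec, mul_nonsing_inv _ hut, one_mulVec]
    simp [dotProduct, sq]
  have hd : Real.sqrt (((2 * Real.pi) • (R * Rᵀ)).det) =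
      Real.sqrt (2 * Real.pi) ^ n * |R.det| := by
    rw [det_smul, det_mul, det_transpose, Fintype.card_fin, Real.sqrt_mul (by positivity),
      Real.sqrt_mul_self_eq_abs]
    congr 1
    rw [Real.sqrt_eq_iff_mul_self_eq (by positivity) (by positivity), ← mul_pow,
      Real.mul_self_sqrt (by positivity)]
  have hne : |R.det| ≠ 0 := abs_ne_zero.mpr hR
  simp only [gaussianDensity, stdNormalProd, stdNormalWeight, add_sub_cancel_left, hq, hd,
    Finset.prod_mul_distrib, Finset.prod_const, Finset.card_univ, Fintype.card_fin,
    ← Real.exp_sum, ← Finset.mul_sum, div_pow, one_pow]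
  field_simp

/-- Change of variables along the affine bijection `z ↦ μ + R z`, whose Jacobian `|det R|` is
absorbed by the density. -/
theorem HasWeightedIntegral.gaussian_of_std {μ : Fin n → ℝ} {R : Matrix (Fin n) (Fin n) ℝ}
    (hR : R.det ≠ 0) {g : (Fin n → ℝ) → ℝ} {v : ℝ}
    (h : HasWeightedIntegral stdNormalProd (fun z => g (μ + R *ᵥ z)) v) :
    HasWeightedIntegral (gaussianDensity μ (R * Rᵀ)) g v := by
  set φ : (Fin n → ℝ) → (Fin n → ℝ) := fun z => μ + R *ᵥ z
  set φ' : (Fin n → ℝ) →L[ℝ] (Fin n → ℝ) := LinearMap.toContinuousLinearMap (toLin' R)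
  have hdet : φ'.det = R.det := by
    rw [ContinuousLinearMap.det, LinearMap.coe_toContinuousLinearMap, LinearMap.det_toLin']
  have hderiv : ∀ x ∈ Set.univ, HasFDerivWithinAt φ φ' Set.univ x := fun x _ =>
    (φ'.hasFDerivAt.const_add μ).hasFDerivWithinAt
  have hinj : Set.InjOn φ Set.univ := fun x _ y _ hxy =>
    mulVec_injective_of_isUnit ((isUnit_iff_isUnit_det R).mpr hR.isUnit) (add_left_cancel hxy)
  have himg : φ '' Set.univ = Set.univ := by
    refine Set.eq_univ_of_forall fun y => ⟨R⁻¹ *ᵥ (y - μ), trivial, ?_⟩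
    simp only [φ]
    rw [mulVec_mulVec, mul_nonsing_inv _ hR.isUnit, one_mulVec, add_sub_cancel]
  have hw : ∀ z, |φ'.det| • (g (φ z) * gaussianDensity μ (R * Rᵀ) (φ z)) =
      g (φ z) * stdNormalProd z := fun z => by
    rw [hdet, smul_eq_mul, mul_left_comm, abs_det_mul_gaussianDensity μ hR]
  have h₁ := integrableOn_image_iff_integrableOn_abs_det_fderiv_smul volume MeasurableSet.univ
    hderiv hinj fun x => g x * gaussianDensity μ (R * Rᵀ) x
  have h₂ := integral_image_eq_integral_abs_det_fderiv_smul volume MeasurableSet.univ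
    hderiv hinj fun x => g x * gaussianDensity μ (R * Rᵀ) x
  simp only [himg, hw, integrableOn_univ, setIntegral_univ] at h₁ h₂
  exact ⟨h₁.mpr h.1, h₂.trans h.2⟩

-- In the C⋆-algebra of matrices a strictly positive element is `b⋆ b` with `b` invertible; `R` is
-- `bᵀ`.
open scoped MatrixOrder Matrix.Norms.L2Operator in
theorem Matrix.PosDef.exists_eq_mul_transpose {S : Matrix (Fin n) (Fin n) ℝ} (hS : S.PosDef) :
    ∃ R : Matrix (Fin n) (Fin n) ℝ, R.det ≠ 0 ∧ S = R * Rᵀ := by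
  obtain ⟨b, hb, rfl⟩ := CStarAlgebra.isStrictlyPositive_iff_eq_star_mul_self.mp
    hS.isStrictlyPositive
  refine ⟨bᵀ, ?_, ?_⟩
  · rw [det_transpose]
    exact ((isUnit_iff_isUnit_det b).mp hb).ne_zero
  · simp [star_eq_conjTranspose, conjTranspose_eq_transpose_of_trivial]

section moments

variable (μ : Fin n → ℝ) {S : Matrix (Fin n) (Fin n) ℝ}

theorem dotProduct_mulVec_mulVec (M R : Matrix (Fin n) (Fin n) ℝ) (z : Fin n → ℝ) :
    (R *ᵥ z) ⬝ᵥ (M *ᵥ (R *ᵥ z)) = z ⬝ᵥ ((Rᵀ * M * R) *ᵥ z) := by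
  rw [mulVec_mulVec, ← vecMul_transpose, ← dotProduct_mulVec, mulVec_mulVec, Matrix.mul_assoc]

theorem transpose_mul_inv_mul_self {R : Matrix (Fin n) (Fin n) ℝ} (hR : R.det ≠ 0) :
    Rᵀ * (R * Rᵀ)⁻¹ * R = 1 := by
  have hut : IsUnit Rᵀ.det := by rw [det_transpose]; exact hR.isUnit
  rw [Matrix.mul_inv_rev, mul_nonsing_inv_cancel_left _ _ hut, nonsing_inv_mul _ hR.isUnit]

theorem hasWeightedIntegral_gaussian_one (hS : S.PosDef) :
    HasWeightedIntegral (gaussianDensity μ S) (fun _ => 1) 1 := by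
  obtain ⟨R, hR, rfl⟩ := hS.exists_eq_mul_transpose
  exact .gaussian_of_std hR hasWeightedIntegral_std_one

theorem hasWeightedIntegral_gaussian_linear (hS : S.PosDef) (w : Fin n → ℝ) :
    HasWeightedIntegral (gaussianDensity μ S) (fun x => w ⬝ᵥ (x - μ)) 0 := by
  obtain ⟨R, hR, rfl⟩ := hS.exists_eq_mul_transpose
  refine .gaussian_of_std hR ((hasWeightedIntegral_std_linear (w ᵥ* R)).congr (fun z => ?_) rfl)
  rw [add_sub_cancel_left, dotProduct_mulVec]

theorem hasWeightedIntegral_gaussian_quadratic (hS : S.PosDef) (M : Matrix (Fin n) (Fin n) ℝ) :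
    HasWeightedIntegral (gaussianDensity μ S) (fun x => (x - μ) ⬝ᵥ (M *ᵥ (x - μ)))
      (M * S).trace := by
  obtain ⟨R, hR, rfl⟩ := hS.exists_eq_mul_transpose
  refine .gaussian_of_std hR ((hasWeightedIntegral_std_quadratic (Rᵀ * M * R)).congr
    (fun z => ?_) ?_)
  · rw [add_sub_cancel_left, dotProduct_mulVec_mulVec]
  · rw [← Matrix.mul_assoc, trace_mul_cycle]

theorem hasWeightedIntegral_gaussian_linear_mul_inv (hS : S.PosDef) (w : Fin n → ℝ) :
    HasWeightedIntegral (gaussianDensity μ S)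
      (fun x => (w ⬝ᵥ (x - μ)) * ((x - μ) ⬝ᵥ (S⁻¹ *ᵥ (x - μ)))) 0 := by
  obtain ⟨R, hR, rfl⟩ := hS.exists_eq_mul_transpose
  refine .gaussian_of_std hR ((hasWeightedIntegral_std_linear_mul_sq (w ᵥ* R)).congr
    (fun z => ?_) rfl)
  rw [add_sub_cancel_left, dotProduct_mulVec_mulVec, transpose_mul_inv_mul_self hR, one_mulVec,
    dotProduct_mulVec]

theorem hasWeightedIntegral_gaussian_quadratic_mul_inv (hS : S.PosDef)
    (M : Matrix (Fin n) (Fin n) ℝ) :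
    HasWeightedIntegral (gaussianDensity μ S)
      (fun x => ((x - μ) ⬝ᵥ (M *ᵥ (x - μ))) * ((x - μ) ⬝ᵥ (S⁻¹ *ᵥ (x - μ))))
      ((n + 2) * (M * S).trace) := by
  obtain ⟨R, hR, rfl⟩ := hS.exists_eq_mul_transpose
  refine .gaussian_of_std hR ((hasWeightedIntegral_std_quadratic_mul_sq (Rᵀ * M * R)).congr
    (fun z => ?_) ?_)
  · rw [add_sub_cancel_left, dotProduct_mulVec_mulVec, dotProduct_mulVec_mulVec,
      transpose_mul_inv_mul_self hR, one_mulVec]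
  · rw [← Matrix.mul_assoc, trace_mul_cycle]

theorem hasWeightedIntegral_gaussian_affine (hS : S.PosDef) (v v' : Fin n → ℝ)
    (W M M' : Matrix (Fin n) (Fin n) ℝ) :
    HasWeightedIntegral (gaussianDensity μ S)
      (fun x => (v + M *ᵥ (x - μ)) ⬝ᵥ (W *ᵥ (v' + M' *ᵥ (x - μ))))
      (v ⬝ᵥ (W *ᵥ v') + (Mᵀ * W * M' * S).trace) := by
  refine ((((hasWeightedIntegral_gaussian_one μ hS).const_mul (v ⬝ᵥ (W *ᵥ v'))).add
    (hasWeightedIntegral_gaussian_linear μ hS (v ᵥ* (W * M') + (W *ᵥ v') ᵥ* M))).add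
    (hasWeightedIntegral_gaussian_quadratic μ hS (Mᵀ * W * M'))).congr (fun x => ?_) (by ring)
  generalize x - μ = y
  have h₁ : (M *ᵥ y) ⬝ᵥ (W *ᵥ (M' *ᵥ y)) = y ⬝ᵥ ((Mᵀ * W * M') *ᵥ y) := by
    rw [← vecMul_transpose, ← dotProduct_mulVec, mulVec_mulVec, mulVec_mulVec, Matrix.mul_assoc]
  have h₂ : (M *ᵥ y) ⬝ᵥ (W *ᵥ v') = ((W *ᵥ v') ᵥ* M) ⬝ᵥ y := by
    rw [dotProduct_comm, dotProduct_mulVec]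
  have h₃ : v ⬝ᵥ (W *ᵥ (M' *ᵥ y)) = (v ᵥ* (W * M')) ⬝ᵥ y := by
    rw [mulVec_mulVec, dotProduct_mulVec]
  rw [mulVec_add, add_dotProduct, dotProduct_add, dotProduct_add, h₁, h₂, h₃, add_dotProduct]
  ring

end moments

/-! ### The logarithm of the density and the entropy integrals -/

theorem det_two_pi_smul_pos {S : Matrix (Fin n) (Fin n) ℝ} (hS : S.PosDef) :
    0 < ((2 * Real.pi) • S).det := by
  rw [det_smul]
  exact mul_pos (by positivity) hS.det_pos

theorem gaussianDensity_eq_exp (μ : Fin n → ℝ) {S : Matrix (Fin n) (Fin n) ℝ} (hS : S.PosDef)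
    (x : Fin n → ℝ) :
    gaussianDensity μ S x = Real.exp (-(1 / 2) * Real.log ((2 * Real.pi) • S).det +
      -(1 / 2) * ((x - μ) ⬝ᵥ (S⁻¹ *ᵥ (x - μ)))) := by
  rw [Real.exp_add, gaussianDensity]
  congr 1
  rw [neg_mul, Real.exp_neg, one_div, one_div, inv_mul_eq_div, ← Real.log_sqrt
    (det_two_pi_smul_pos hS).le, Real.exp_log (Real.sqrt_pos.mpr (det_two_pi_smul_pos hS))]

theorem log_gaussianDensity (μ : Fin n → ℝ) {S : Matrix (Fin n) (Fin n) ℝ} (hS : S.PosDef)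
    (x : Fin n → ℝ) :
    Real.log (gaussianDensity μ S x) = -(1 / 2) * Real.log ((2 * Real.pi) • S).det +
      -(1 / 2) * ((x - μ) ⬝ᵥ (S⁻¹ *ᵥ (x - μ))) := by
  rw [gaussianDensity_eq_exp μ hS, Real.log_exp]

theorem inv_mul_self_trace {S : Matrix (Fin n) (Fin n) ℝ} (hS : S.PosDef) :
    (S⁻¹ * S).trace = n := by
  rw [nonsing_inv_mul _ hS.det_pos.ne'.isUnit, trace_one, Fintype.card_fin]

theorem inv_transpose_eq {S : Matrix (Fin n) (Fin n) ℝ} (hS : S.PosDef) : S⁻¹ᵀ = S⁻¹ := by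
  rw [transpose_nonsing_inv, ← conjTranspose_eq_transpose_of_trivial, hS.isHermitian.eq]

theorem hasWeightedIntegral_log_gaussianDensity (μ : Fin n → ℝ) {S : Matrix (Fin n) (Fin n) ℝ}
    (hS : S.PosDef) :
    HasWeightedIntegral (gaussianDensity μ S) (fun x => Real.log (gaussianDensity μ S x))
      (-(1 / 2) * Real.log ((2 * Real.pi) • S).det - n / 2) := by
  refine (((hasWeightedIntegral_gaussian_one μ hS).const_mul
    (-(1 / 2) * Real.log ((2 * Real.pi) • S).det)).add
    ((hasWeightedIntegral_gaussian_quadratic μ hS S⁻¹).const_mul (-(1 / 2)))).congr (fun x => ?_) ?_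
  · rw [log_gaussianDensity μ hS, mul_one]
  · rw [inv_mul_self_trace hS]
    ring

theorem densityEntropy_gaussianDensity (μ : Fin n → ℝ) {S : Matrix (Fin n) (Fin n) ℝ}
    (hS : S.PosDef) :
    densityEntropy (gaussianDensity μ S) =
      1 / 2 * Real.log S.det + (n * Real.log (2 * Real.pi) + n) / 2 := by
  have h := (hasWeightedIntegral_log_gaussianDensity μ hS).2
  simp only [mul_comm (Real.log _)] at h
  rw [densityEntropy, h, det_smul, Fintype.card_fin,
    Real.log_mul (by positivity) hS.det_pos.ne', Real.log_pow]
  ring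

/-- The bracket is the logarithmic time derivative of the density, with `w = S⁻¹ μ'`. The constant
`c` in `ln p` drops out, since the bracket has mean zero; what remains is `n τ / 4 - (n + 2) τ / 4 =
-τ / 2`. -/
theorem hasWeightedIntegral_entropyRate (μ : Fin n → ℝ) {S : Matrix (Fin n) (Fin n) ℝ}
    (hS : S.PosDef) (w : Fin n → ℝ) (S' : Matrix (Fin n) (Fin n) ℝ) :
    HasWeightedIntegral (gaussianDensity μ S)
      (fun x => (-(1 / 2) * (S⁻¹ * S').trace + w ⬝ᵥ (x - μ) +
        1 / 2 * ((x - μ) ⬝ᵥ ((S⁻¹ * S' * S⁻¹) *ᵥ (x - μ)))) *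
        Real.log (gaussianDensity μ S x))
      (-(1 / 2 * (S⁻¹ * S').trace)) := by
  set c := -(1 / 2) * Real.log ((2 * Real.pi) • S).det
  set τ := (S⁻¹ * S').trace
  have hτ : (S⁻¹ * S' * S⁻¹ * S).trace = τ := by
    rw [Matrix.mul_assoc _ S⁻¹ S, nonsing_inv_mul _ hS.det_pos.ne'.isUnit, Matrix.mul_one]
  refine (((((((hasWeightedIntegral_gaussian_one μ hS).const_mul (-(1 / 2) * τ * c)).add
    ((hasWeightedIntegral_gaussian_linear μ hS w).const_mul c)).add
    ((hasWeightedIntegral_gaussian_quadratic μ hS (S⁻¹ * S' * S⁻¹)).const_mul (c / 2))).add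
    ((hasWeightedIntegral_gaussian_quadratic μ hS S⁻¹).const_mul (τ / 4))).add
    ((hasWeightedIntegral_gaussian_linear_mul_inv μ hS w).const_mul (-(1 / 2)))).add
    ((hasWeightedIntegral_gaussian_quadratic_mul_inv μ hS (S⁻¹ * S' * S⁻¹)).const_mul
      (-(1 / 4)))).congr (fun x => ?_) ?_
  · rw [log_gaussianDensity μ hS]
    ring
  · rw [hτ, inv_mul_self_trace hS]
    ring

/-! ### Space and time derivatives of the density -/

theorem partialDeriv_gaussianDensity (μ : Fin n → ℝ) {S : Matrix (Fin n) (Fin n) ℝ}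
    (hS : S.PosDef) (j : Fin n) (x : Fin n → ℝ) :
    partialDeriv (gaussianDensity μ S) j x =
      -(S⁻¹ *ᵥ (x - μ)) j * gaussianDensity μ S x := by
  have hline : ∀ i, HasDerivWithinAt (fun s : ℝ => (x + s • (Pi.single j 1 : Fin n → ℝ) - μ) i)
      ((Pi.single j 1 : Fin n → ℝ) i) Set.univ 0 := fun i => by
    simpa using (((hasDerivWithinAt_id (0 : ℝ) Set.univ).mul_const
      ((Pi.single j 1 : Fin n → ℝ) i)).const_add (x i)).sub_const (μ i)
  have hq := hasDerivWithinAt_dotProduct hline (hasDerivWithinAt_mulVec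
    (P := fun _ => S⁻¹) (P' := 0) (fun i j => hasDerivWithinAt_const _ _ _) hline)
  have he := ((hq.const_mul (-(1 / 2))).const_add
    (-(1 / 2) * Real.log ((2 * Real.pi) • S).det)).exp
  rw [hasDerivWithinAt_univ] at he
  rw [partialDeriv, lineDeriv]
  simp only [gaussianDensity_eq_exp μ hS]
  rw [he.deriv]
  have hsymm : (x - μ) ⬝ᵥ (S⁻¹ *ᵥ Pi.single j 1) = (S⁻¹ *ᵥ (x - μ)) j := by
    rw [dotProduct_mulVec, dotProduct_single, mul_one, ← mulVec_transpose, inv_transpose_eq hS]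
  simp only [zero_smul, add_zero, zero_mulVec, zero_add, single_dotProduct, one_mul, hsymm]
  ring

theorem hasDerivWithinAt_gaussianDensity {μ : ℝ → Fin n → ℝ} {S : ℝ → Matrix (Fin n) (Fin n) ℝ}
    {μ' : Fin n → ℝ} {S' : Matrix (Fin n) (Fin n) ℝ} {T : Set ℝ} {t : ℝ} (ht : t ∈ T)
    (hT : UniqueDiffWithinAt ℝ T t) (hS : ∀ s ∈ T, (S s).PosDef)
    (hμ' : ∀ i, HasDerivWithinAt (fun s => μ s i) (μ' i) T t)
    (hS' : ∀ i j, HasDerivWithinAt (fun s => S s i j) (S' i j) T t) (x : Fin n → ℝ) :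
    HasDerivWithinAt (fun s => gaussianDensity (μ s) (S s) x)
      ((-(1 / 2) * ((S t)⁻¹ * S').trace + ((S t)⁻¹ *ᵥ μ') ⬝ᵥ (x - μ t) +
        1 / 2 * ((x - μ t) ⬝ᵥ (((S t)⁻¹ * S' * (S t)⁻¹) *ᵥ (x - μ t)))) *
        gaussianDensity (μ t) (S t) x) T t := by
  have hy : ∀ i, HasDerivWithinAt (fun s => (x - μ s) i) ((-μ') i) T t := fun i =>
    (hμ' i).const_sub (x i)
  have hdet : ∀ s ∈ T, (S s).det ≠ 0 := fun s hs => (hS s hs).det_pos.ne'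
  have hq := hasDerivWithinAt_dotProduct hy (hasDerivWithinAt_mulVec
    (hasDerivWithinAt_inv_apply ht hT hS' hdet) hy)
  have hl := ((hasDerivWithinAt_log_det hS' (hdet t ht)).const_add
    (n * Real.log (2 * Real.pi))).const_mul (-(1 / 2))
  refine ((hl.add (hq.const_mul (-(1 / 2)))).exp.congr_of_mem (fun s hs => ?_) ht).congr_deriv ?_
  · rw [gaussianDensity_eq_exp _ (hS s hs), det_smul, Fintype.card_fin,
      Real.log_mul (by positivity) (hdet s hs), Real.log_pow]
    rfl
  · rw [gaussianDensity_eq_exp _ (hS t ht), det_smul, Fintype.card_fin,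
      Real.log_mul (by positivity) (hdet t ht), Real.log_pow, mul_comm]
    have h₁ : (x - μ t) ⬝ᵥ ((S t)⁻¹ *ᵥ μ') = ((S t)⁻¹ *ᵥ μ') ⬝ᵥ (x - μ t) := dotProduct_comm _ _
    have h₂ : μ' ⬝ᵥ ((S t)⁻¹ *ᵥ (x - μ t)) = ((S t)⁻¹ *ᵥ μ') ⬝ᵥ (x - μ t) := by
      rw [dotProduct_mulVec, ← mulVec_transpose, inv_transpose_eq (hS t ht)]
    simp only [neg_dotProduct, dotProduct_add, neg_mulVec, mulVec_neg, dotProduct_neg, h₁, h₂]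
    congr 1
    ring

/-! ### The current and the two integrands -/

theorem inv_mulVec_of_isDiag {D : Matrix (Fin n) (Fin n) ℝ} (hD : D.IsDiag)
    (hpos : ∀ i, 0 < D i i) (v : Fin n → ℝ) (i : Fin n) : (D⁻¹ *ᵥ v) i = v i / D i i := by
  have h : D⁻¹ = diagonal fun i => (D i i)⁻¹ := by
    refine inv_eq_left_inv ?_
    conv_lhs => rw [← hD.diagonal_diag]
    simp only [diagonal_apply_eq, diag_apply]
    rw [diagonal_mul_diagonal, ← diagonal_one]
    congr 1
    funext i
    exact inv_mul_cancel₀ (hpos i).ne'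
  rw [h, mulVec_diagonal, div_eq_inv_mul]

theorem probabilityCurrent_gaussianDensity (μ : Fin n → ℝ) {S D : Matrix (Fin n) (Fin n) ℝ}
    (hS : S.PosDef) (f : (Fin n → ℝ) → Fin n → ℝ) (i : Fin n) (x : Fin n → ℝ) :
    probabilityCurrent D f (gaussianDensity μ S) i x =
      (f x + (D * S⁻¹) *ᵥ (x - μ)) i * gaussianDensity μ S x := by
  simp only [probabilityCurrent, partialDeriv_gaussianDensity μ hS, ← mulVec_mulVec, Pi.add_apply,
    add_mul]
  rw [mulVec, dotProduct, Finset.sum_mul, sub_eq_add_neg, ← Finset.sum_neg_distrib]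
  congr 1
  exact Finset.sum_congr rfl fun j _ => by ring

theorem entropyProductionIntegrand_gaussianDensity {μ : Fin n → ℝ}
    {S D : Matrix (Fin n) (Fin n) ℝ} (hS : S.PosDef) (hD : D.IsDiag) (hpos : ∀ i, 0 < D i i)
    {f : (Fin n → ℝ) → Fin n → ℝ} (x : Fin n → ℝ) :
    entropyProductionIntegrand D f (gaussianDensity μ S) x =
      (f x + (D * S⁻¹) *ᵥ (x - μ)) ⬝ᵥ (D⁻¹ *ᵥ (f x + (D * S⁻¹) *ᵥ (x - μ))) *
        gaussianDensity μ S x := by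
  have hp : gaussianDensity μ S x ≠ 0 := by
    rw [gaussianDensity_eq_exp μ hS]
    exact Real.exp_ne_zero _
  rw [entropyProductionIntegrand, dotProduct, Finset.sum_mul]
  refine Finset.sum_congr rfl fun i _ => ?_
  rw [probabilityCurrent_gaussianDensity μ hS, inv_mulVec_of_isDiag hD hpos]
  have := (hpos i).ne'
  field_simp

theorem entropyFluxIntegrand_gaussianDensity {μ : Fin n → ℝ}
    {S D : Matrix (Fin n) (Fin n) ℝ} (hS : S.PosDef) (hD : D.IsDiag) (hpos : ∀ i, 0 < D i i)
    {f : (Fin n → ℝ) → Fin n → ℝ} (x : Fin n → ℝ) :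
    entropyFluxIntegrand D f (gaussianDensity μ S) x =
      (f x + (D * S⁻¹) *ᵥ (x - μ)) ⬝ᵥ (D⁻¹ *ᵥ f x) * gaussianDensity μ S x := by
  rw [entropyFluxIntegrand, dotProduct, Finset.sum_mul]
  refine Finset.sum_congr rfl fun i _ => ?_
  rw [probabilityCurrent_gaussianDensity μ hS, inv_mulVec_of_isDiag hD hpos]
  ring

/-! ### Trace identities -/

theorem trace_entropyProduction {S D : Matrix (Fin n) (Fin n) ℝ} (A : Matrix (Fin n) (Fin n) ℝ)
    (hS : S.PosDef) (hD : D.IsDiag) (hu : IsUnit D.det) :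
    ((A + D * S⁻¹)ᵀ * D⁻¹ * (A + D * S⁻¹) * S).trace =
      (Aᵀ * D⁻¹ * A * S).trace + (S⁻¹ * D).trace + 2 * A.trace := by
  have hSu : IsUnit S.det := hS.det_pos.ne'.isUnit
  -- Symmetry of `S⁻¹` and `D` gives `(D S⁻¹)ᵀ D⁻¹ = S⁻¹`. The two middle terms are the cross terms,
  -- each of trace `Tr A`.
  have h : (A + D * S⁻¹)ᵀ * D⁻¹ * (A + D * S⁻¹) * S =
      Aᵀ * D⁻¹ * A * S + Aᵀ + S⁻¹ * A * S + S⁻¹ * D := by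
    rw [transpose_add, transpose_mul, inv_transpose_eq hS, hD.isSymm.eq, Matrix.add_mul,
      mul_nonsing_inv_cancel_right _ _ hu]
    simp only [Matrix.add_mul, Matrix.mul_add, Matrix.mul_assoc, nonsing_inv_mul _ hSu,
      Matrix.mul_one, nonsing_inv_mul _ hu]
    abel
  have hc : (S⁻¹ * A * S).trace = A.trace := by
    rw [trace_mul_cycle, mul_nonsing_inv _ hSu, Matrix.one_mul]
  rw [h, trace_add, trace_add, trace_add, trace_transpose, hc]
  ring

theorem trace_entropyFlux {S D : Matrix (Fin n) (Fin n) ℝ} (A : Matrix (Fin n) (Fin n) ℝ)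
    (hS : S.PosDef) (hD : D.IsDiag) (hu : IsUnit D.det) :
    ((A + D * S⁻¹)ᵀ * D⁻¹ * A * S).trace = (Aᵀ * D⁻¹ * A * S).trace + A.trace := by
  have hSu : IsUnit S.det := hS.det_pos.ne'.isUnit
  rw [transpose_add, transpose_mul, inv_transpose_eq hS, hD.isSymm.eq, Matrix.add_mul,
    mul_nonsing_inv_cancel_right _ _ hu, Matrix.add_mul, Matrix.add_mul, trace_add,
    trace_mul_cycle S⁻¹, mul_nonsing_inv _ hSu, Matrix.one_mul]

theorem trace_inv_mul_lyapunov {S : Matrix (Fin n) (Fin n) ℝ} (A D : Matrix (Fin n) (Fin n) ℝ)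
    (hS : S.PosDef) :
    (S⁻¹ * (A * S + S * Aᵀ + (2 : ℝ) • D)).trace = 2 * ((S⁻¹ * D).trace + A.trace) := by
  have hSu : IsUnit S.det := hS.det_pos.ne'.isUnit
  rw [Matrix.mul_add, Matrix.mul_add, trace_add, trace_add, nonsing_inv_mul_cancel_left _ _ hSu,
    ← Matrix.mul_assoc, trace_mul_cycle, mul_nonsing_inv _ hSu, Matrix.one_mul, trace_transpose,
    mul_smul_comm, trace_smul, smul_eq_mul]
  ring

theorem isUnit_det_of_isDiag {D : Matrix (Fin n) (Fin n) ℝ} (hD : D.IsDiag)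
    (hpos : ∀ i, 0 < D i i) : IsUnit D.det := by
  rw [← hD.diagonal_diag, det_diagonal]
  exact (Finset.prod_pos fun i _ => hpos i).ne'.isUnit

/-- Two distinct points give the convex set `T` nonempty interior, which makes derivatives within
`T` unique even at its end points. -/
theorem Set.OrdConnected.uniqueDiffWithinAt_of_nontrivial {T : Set ℝ} (hT : T.OrdConnected)
    (hnt : T.Nontrivial) {t : ℝ} (ht : t ∈ T) : UniqueDiffWithinAt ℝ T t := by
  obtain ⟨a, ha, b, hb, hab⟩ := hnt.exists_lt
  refine uniqueDiffWithinAt_convex hT.convex ⟨(a + b) / 2, ?_⟩ (subset_closure ht)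
  exact interior_mono (hT.out ha hb) (by rw [interior_Icc]; constructor <;> linarith)

end

theorem mainTheorem1 {n m : ℕ}
    -- the time interval, of positive length, open or closed at either end, possibly unbounded
    (T : Set ℝ) (hT : T.OrdConnected) (hT_nontrivial : T.Nontrivial)
    -- the linear Langevin system, with diagonal positive noise matrix
    (A : Matrix (Fin n) (Fin n) ℝ) (B : Matrix (Fin n) (Fin m) ℝ) (u : ℝ → Fin m → ℝ)
    (D : ℝ → Matrix (Fin n) (Fin n) ℝ)
    (hD_diag : ∀ t ∈ T, (D t).IsDiag) (hD_pos : ∀ t ∈ T, ∀ i, 0 < D t i i)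
    -- mean and covariance, with their time derivatives
    (μ μ' : ℝ → Fin n → ℝ) (S S' : ℝ → Matrix (Fin n) (Fin n) ℝ)
    (hS : ∀ t ∈ T, (S t).PosDef)
    (hμ_deriv : ∀ t ∈ T, ∀ i, HasDerivWithinAt (fun s => μ s i) (μ' t i) T t)
    (hS_deriv : ∀ t ∈ T, ∀ i j, HasDerivWithinAt (fun s => S s i j) (S' t i j) T t)
    (hμ_eq : ∀ t ∈ T, μ' t = A *ᵥ μ t + B *ᵥ u t)
    (hS_eq : ∀ t ∈ T, S' t = A * S t + S t * Aᵀ + (2 : ℝ) • D t)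
    -- the drift and the Gaussian density at each time
    (f : ℝ → (Fin n → ℝ) → Fin n → ℝ) (hf : ∀ t, f t = linearDrift A B (u t))
    (p : ℝ → (Fin n → ℝ) → ℝ) (hp : ∀ t, p t = gaussianDensity (μ t) (S t))
    (t : ℝ) (ht : t ∈ T) :
    -- entropy production
    (Integrable (entropyProductionIntegrand (D t) (f t) (p t)) ∧
      entropyProduction (D t) (f t) (p t) =
        μ' t ⬝ᵥ ((D t)⁻¹ *ᵥ μ' t) + (Aᵀ * (D t)⁻¹ * A * S t).trace
          + ((S t)⁻¹ * D t).trace + 2 * A.trace) ∧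
    -- entropy flux
    (Integrable (entropyFluxIntegrand (D t) (f t) (p t)) ∧
      entropyFlux (D t) (f t) (p t) =
        μ' t ⬝ᵥ ((D t)⁻¹ *ᵥ μ' t) + (Aᵀ * (D t)⁻¹ * A * S t).trace + A.trace) ∧
    -- the entropy is differentiable in time, and its derivative is `Π - Φ`
    (Integrable (fun x => p t x * Real.log (p t x)) ∧
      HasDerivWithinAt (fun s => densityEntropy (p s))
        (entropyProduction (D t) (f t) (p t) - entropyFlux (D t) (f t) (p t)) T t) ∧
    -- the same rate as the integral `-∫ (∂p/∂t) ln p`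
    ((∀ x, DifferentiableWithinAt ℝ (fun s => p s x) T t) ∧
      Integrable (fun x => derivWithin (fun s => p s x) T t * Real.log (p t x)) ∧
      -∫ x, derivWithin (fun s => p s x) T t * Real.log (p t x) =
        entropyProduction (D t) (f t) (p t) - entropyFlux (D t) (f t) (p t)) ∧
    -- its values
    (entropyProduction (D t) (f t) (p t) - entropyFlux (D t) (f t) (p t) =
        ((S t)⁻¹ * D t).trace + A.trace ∧
      ((S t)⁻¹ * D t).trace + A.trace = 1 / 2 * ((S t)⁻¹ * S' t).trace ∧
      HasDerivWithinAt (fun s => 1 / 2 * Real.log (S s).det)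
        (1 / 2 * ((S t)⁻¹ * S' t).trace) T t) := by
  have hU : UniqueDiffWithinAt ℝ T t := hT.uniqueDiffWithinAt_of_nontrivial hT_nontrivial ht
  have hSt := hS t ht
  have hDd := hD_diag t ht
  have hDp := hD_pos t ht
  have hDu := isUnit_det_of_isDiag hDd hDp
  -- The mean equation absorbs the input: `B u = μ' - A μ`.
  have hft : ∀ x, f t x = μ' t + A *ᵥ (x - μ t) := fun x => by
    rw [hf, linearDrift, hμ_eq t ht, mulVec_sub]
    abel
  have hJ : ∀ x, f t x + (D t * (S t)⁻¹) *ᵥ (x - μ t) =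
      μ' t + (A + D t * (S t)⁻¹) *ᵥ (x - μ t) := fun x => by
    rw [hft, add_mulVec, add_assoc]
  have hprod := hasWeightedIntegral_gaussian_affine (μ t) hSt (μ' t) (μ' t) (D t)⁻¹
    (A + D t * (S t)⁻¹) (A + D t * (S t)⁻¹)
  have hflux := hasWeightedIntegral_gaussian_affine (μ t) hSt (μ' t) (μ' t) (D t)⁻¹
    (A + D t * (S t)⁻¹) A
  rw [trace_entropyProduction A hSt hDd hDu] at hprod
  rw [trace_entropyFlux A hSt hDd hDu] at hflux
  have hprodi : entropyProductionIntegrand (D t) (f t) (p t) = fun x =>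
      (μ' t + (A + D t * (S t)⁻¹) *ᵥ (x - μ t)) ⬝ᵥ
        ((D t)⁻¹ *ᵥ (μ' t + (A + D t * (S t)⁻¹) *ᵥ (x - μ t))) *
        gaussianDensity (μ t) (S t) x := funext fun x => by
    rw [hp, entropyProductionIntegrand_gaussianDensity hSt hDd hDp, hJ]
  have hfluxi : entropyFluxIntegrand (D t) (f t) (p t) = fun x =>
      (μ' t + (A + D t * (S t)⁻¹) *ᵥ (x - μ t)) ⬝ᵥ
        ((D t)⁻¹ *ᵥ (μ' t + A *ᵥ (x - μ t))) * gaussianDensity (μ t) (S t) x := funext fun x => by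
    rw [hp, entropyFluxIntegrand_gaussianDensity hSt hDd hDp, hJ, hft]
  have hprodv : entropyProduction (D t) (f t) (p t) = μ' t ⬝ᵥ ((D t)⁻¹ *ᵥ μ' t) +
      (Aᵀ * (D t)⁻¹ * A * S t).trace + ((S t)⁻¹ * D t).trace + 2 * A.trace := by
    rw [entropyProduction, hprodi, hprod.2]
    ring
  have hfluxv : entropyFlux (D t) (f t) (p t) = μ' t ⬝ᵥ ((D t)⁻¹ *ᵥ μ' t) +
      (Aᵀ * (D t)⁻¹ * A * S t).trace + A.trace := by
    rw [entropyFlux, hfluxi, hflux.2]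
    ring
  have hdiff : entropyProduction (D t) (f t) (p t) - entropyFlux (D t) (f t) (p t) =
      ((S t)⁻¹ * D t).trace + A.trace := by
    rw [hprodv, hfluxv]
    ring
  have htr : ((S t)⁻¹ * D t).trace + A.trace = 1 / 2 * ((S t)⁻¹ * S' t).trace := by
    rw [hS_eq t ht, trace_inv_mul_lyapunov A (D t) hSt]
    ring
  have hlog := (hasDerivWithinAt_log_det (hS_deriv t ht) hSt.det_pos.ne').const_mul (1 / 2 : ℝ)
  have hpd : ∀ x, HasDerivWithinAt (fun s => p s x)
      ((-(1 / 2) * ((S t)⁻¹ * S' t).trace + ((S t)⁻¹ *ᵥ μ' t) ⬝ᵥ (x - μ t) +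
        1 / 2 * ((x - μ t) ⬝ᵥ (((S t)⁻¹ * S' t * (S t)⁻¹) *ᵥ (x - μ t)))) *
        gaussianDensity (μ t) (S t) x) T t := fun x => by
    simp only [hp]
    exact hasDerivWithinAt_gaussianDensity ht hU hS (hμ_deriv t ht) (hS_deriv t ht) x
  have hrate := hasWeightedIntegral_entropyRate (μ t) hSt ((S t)⁻¹ *ᵥ μ' t) (S' t)
  have hri : (fun x => derivWithin (fun s => p s x) T t * Real.log (p t x)) = fun x =>
      (-(1 / 2) * ((S t)⁻¹ * S' t).trace + ((S t)⁻¹ *ᵥ μ' t) ⬝ᵥ (x - μ t) +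
        1 / 2 * ((x - μ t) ⬝ᵥ (((S t)⁻¹ * S' t * (S t)⁻¹) *ᵥ (x - μ t)))) *
        Real.log (gaussianDensity (μ t) (S t) x) * gaussianDensity (μ t) (S t) x :=
    funext fun x => by rw [(hpd x).derivWithin hU, hp, mul_right_comm]
  have hent := hasWeightedIntegral_log_gaussianDensity (μ t) hSt
  refine ⟨⟨hprodi ▸ hprod.1, hprodv⟩, ⟨hfluxi ▸ hflux.1, hfluxv⟩, ⟨?_, ?_⟩,
    ⟨fun x => (hpd x).differentiableWithinAt, hri ▸ hrate.1, ?_⟩, hdiff, htr, hlog⟩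
  · rw [hp]
    simpa only [mul_comm (Real.log _)] using hent.1
  · rw [hdiff, htr]
    -- On all of `T` the entropy agrees with its closed form, which differs from `½ ln det Σ` by
    -- this constant.
    refine (hlog.add_const ((n * Real.log (2 * Real.pi) + n) / 2)).congr_of_mem (fun s hs => ?_) ht
    rw [hp, densityEntropy_gaussianDensity _ (hS s hs)]
  · rw [hri, hrate.2, hdiff, htr, neg_neg]
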